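/- Let $n\ge 2$ be an integer. Let $R$ be a commutative associative ring with unity. The following statements are equivalent: 1. every matrix in $M_n(R)$ is a sum of (finitely many) $3$rd powers of matrices in $M_n(R)$; 2. every matrix in $M_n(R)$ is a sum of (finitely many) $9$th powers of matrices in $M_n(R)$; 3. every element of $R$ is a cube modulo $3R$, i.e. for every $x\in R$ there is $y\in R$ with $x-y^3\in 3R$. In particular, if $R$ is an order in an algebraic number field $K$ (a subring of $K$ that is a finitely generated $\mathbb Z$-module of rank $[K:\mathbb Q]$), then (1), (2), (3) are further equivalent to $(3,\operatorname{disc} R)=1$, where $\operatorname{disc} R$ is the determinant of the trace form of $R$ in a $\mathbb Z$-basis of $R$. Moreover, for every commutative ring $R$ with unity and every $M\in M_n(R)$: 4. $M$ is a sum of $9$th powers of matrices in $M_n(R)$ if and only if there are $a_0,a_1\in R$ with $\operatorname{tr}(M)\equiv a_0^9+3a_1^3 \pmod{9R}$; 5. if $s\ge 2$ is an integer and $\operatorname{tr}(M)\in W(3,s,R)$, then $M$ is a sum of $9$th powers of matrices in $M_n(R)$, where, for a prime $p$, $$W(p,s,R)=\{a_0^{p^s}+p\,a_1^{p^{s-1}}+p^2a_2^{p^{s-2}}+\cdots+p^sa_s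 \mid a_0,\dots,a_s\in R\}.$$ -/

import Mathlib

/-- `a` is a (finite) sum of `k`-th powers of elements of the ring `A`. -/
def IsSumOfPowers {A : Type*} [Ring A] (k : ℕ) (a : A) : Prop :=
  ∃ (m : ℕ) (x : Fin m → A), a = ∑ i, x i ^ k

/-- Every element of `R` is a `k`-th power modulo the ideal `cR`. -/
def EveryElementIsPowerMod (R : Type*) [CommRing R] (k : ℕ) (c : R) : Prop :=
  ∀ x : R, ∃ y : R, x - y ^ k ∈ Ideal.span {c}

/-- The set `W(p, s, R)` of all `a₀^(p^s) + p a₁^(p^(s-1)) + ⋯ + p^s aₛ`. -/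
def wittSet (p s : ℕ) (R : Type*) [CommRing R] : Set R :=
  {x | ∃ a : ℕ → R, x = ∑ i ∈ Finset.range (s + 1), (p : R) ^ i * a i ^ p ^ (s - i)}

/-- A subring `O` of a number field `K` is an order if it is a finitely generated `ℤ`-module
of maximal rank `[K : ℚ]`. -/
structure IsOrder {K : Type*} [Field K] [NumberField K] (O : Subring K) : Prop where
  finite : Module.Finite ℤ O
  rank_eq : Module.finrank ℤ O = Module.finrank ℚ K

/-- An order is a free `ℤ`-module. -/
theorem IsOrder.free {K : Type*} [Field K] [NumberField K] {O : Subring K} (hO : IsOrder O) :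
    Module.Free ℤ O := by
  have := hO.finite
  infer_instance

/-- The discriminant of an order: the determinant of the trace form in a `ℤ`-basis. -/
noncomputable def IsOrder.disc {K : Type*} [Field K] [NumberField K] {O : Subring K}
    (hO : IsOrder O) : ℤ :=
  haveI := hO.finite
  haveI := hO.free
  Algebra.discr ℤ (Module.Free.chooseBasis ℤ O)

/-- The discriminant does not depend on the choice of the `ℤ`-basis. -/
theorem IsOrder.disc_eq {K : Type*} [Field K] [NumberField K] {O : Subring K}
    (hO : IsOrder O) {ι : Type*} [Fintype ι] [DecidableEq ι] (b : Module.Basis ι ℤ O) :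
    hO.disc = Algebra.discr ℤ b := by
  have := hO.finite
  have := hO.free
  let e := (Module.Free.chooseBasis ℤ O).indexEquiv b
  unfold IsOrder.disc
  rw [← Algebra.discr_reindex ℤ b e.symm]
  have := Algebra.discr_eq_discr O (Module.Free.chooseBasis ℤ O) (b.reindex e.symm)
  rw [this]
  congr 1
  ext i
  simp

/-!
Fix an odd `k`. Sums of `k`-th powers in a matrix ring form an additive subgroup, and it contains
every matrix of trace zero: it contains all idempotents, and the differences of rank one
idempotents `u wᵗ` give all off-diagonal matrix units and all `x (eᵢᵢ - eⱼⱼ)`. Hence a matrix is a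
sum of `k`-th powers if and only if its trace lies in the group generated by the traces of `k`-th
powers (`Matrix.mem_powerSubgroup_iff_trace_mem`), and the problem is to find that group.

*Upper bound.* `wittSet p s R` is the range of the `s`-th ghost component `𝕎 R → R`, so it is a
subring. The trace of `A ^ p ^ s` is a sum over closed walks of length `p ^ s`, on which the cyclic
group of that order acts by rotation; an orbit of size `p ^ j` contributes
`p ^ j * y ^ p ^ (s - j)`, an element of `wittSet p s R`
(`Matrix.trace_pow_prime_pow_mem_wittSubring`).

*Lower bound.* Traces of powers of the `2 × 2` matrices `!![t, -d; 1, 0]` are Dickson polynomials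
in `t` and `d`. For `k = 3` they give `a ^ 3 + 3 * b`. For `k = 9`, integral combinations of them
give `18 * x`, then, by an identity modulo `2`, also `9 * x`
(`nine_mul_mem_tracePowerSubgroup`), and modulo `9 * R` the polynomial at `t = 1` is
`1 - 3 * d ^ 3`. So the groups of traces for `k = 3` and `k = 9` are exactly `wittSet 3 1 R` and
`wittSet 3 2 R`, and the equivalences for a general ring follow by substitution.

*Orders.* Every element of an order `O` is a cube modulo `3 * O` if and only if the Frobenius of the
finite ring `ZMod 3 ⊗ O` is surjective, that is injective, that is if the ring is reduced. Over a
perfect field this means that the trace form is nondegenerate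
(`Algebra.discr_ne_zero_iff_isReduced`), and the discriminant commutes with base change.
-/

/-! ### Sums of powers of matrices depend only on the trace -/

/-- The additive subgroup generated by the `k`-th powers. -/
def powerSubgroup (A : Type*) [Ring A] (k : ℕ) : AddSubgroup A :=
  AddSubgroup.closure (Set.range fun a : A => a ^ k)

section PowerSubgroup

variable {A : Type*} [Ring A] {k : ℕ}

theorem pow_mem_powerSubgroup (a : A) : a ^ k ∈ powerSubgroup A k :=
  AddSubgroup.subset_closure ⟨a, rfl⟩

theorem IsIdempotentElem.mem_powerSubgroup {e : A} (he : IsIdempotentElem e) (hk : k ≠ 0) :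
    e ∈ powerSubgroup A k := by
  have := pow_mem_powerSubgroup (k := k) e
  rwa [he.pow_eq hk] at this

/-- For odd `k` the set of `k`-th powers is stable under negation, so that sums of `k`-th powers
already form a subgroup. -/
theorem isSumOfPowers_iff_mem_powerSubgroup (hk : Odd k) {a : A} :
    IsSumOfPowers k a ↔ a ∈ powerSubgroup A k := by
  constructor
  · rintro ⟨m, x, rfl⟩
    exact sum_mem fun i _ => pow_mem_powerSubgroup _
  · intro ha
    induction ha using AddSubgroup.closure_induction with
    | mem a ha =>
      obtain ⟨b, rfl⟩ := ha
      exact ⟨1, fun _ => b, by simp⟩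
    | zero => exact ⟨0, Fin.elim0, by simp⟩
    | add a b _ _ iha ihb =>
      obtain ⟨l, x, rfl⟩ := iha
      obtain ⟨m, y, rfl⟩ := ihb
      exact ⟨l + m, Fin.append x y, by simp [Fin.sum_univ_add]⟩
    | neg a _ iha =>
      obtain ⟨l, x, rfl⟩ := iha
      exact ⟨l, fun i => -x i, by simp [hk.neg_pow]⟩

end PowerSubgroup

section Trace

open Matrix

variable {ι R : Type*} [Fintype ι] [DecidableEq ι] [CommRing R] {k : ℕ}

theorem Matrix.vecMulVec_mem_powerSubgroup {u w : ι → R} (h : w ⬝ᵥ u = 1) (hk : k ≠ 0) :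
    vecMulVec u w ∈ powerSubgroup (Matrix ι ι R) k := by
  refine IsIdempotentElem.mem_powerSubgroup ?_ hk
  simp [IsIdempotentElem, vecMulVec_mul_vecMulVec, h]

/-- If `w₀` and `w₀ + w` both pair to `1` with `u`, then `u wᵗ` is a difference of two rank one
idempotents. -/
theorem Matrix.vecMulVec_mem_powerSubgroup_of_dotProduct_eq_zero {u w w₀ : ι → R}
    (h₀ : w₀ ⬝ᵥ u = 1) (h : w ⬝ᵥ u = 0) (hk : k ≠ 0) :
    vecMulVec u w ∈ powerSubgroup (Matrix ι ι R) k := by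
  have h₁ : (w₀ + w) ⬝ᵥ u = 1 := by rw [add_dotProduct, h₀, h, add_zero]
  have := sub_mem (vecMulVec_mem_powerSubgroup h₁ hk) (vecMulVec_mem_powerSubgroup h₀ hk)
  rwa [vecMulVec_add, add_sub_cancel_left] at this

omit [Fintype ι] in
theorem Matrix.vecMulVec_single_one_single (i j : ι) (x : R) :
    vecMulVec (Pi.single i 1) (Pi.single j x) = single i j x := by
  ext a b
  simp only [vecMulVec_apply, single_apply, Pi.single_apply, ite_mul, one_mul, zero_mul,
    ite_and, eq_comm]

theorem Matrix.single_mem_powerSubgroup {i j : ι} (hij : i ≠ j) (x : R) (hk : k ≠ 0) :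
    single i j x ∈ powerSubgroup (Matrix ι ι R) k := by
  have := vecMulVec_mem_powerSubgroup_of_dotProduct_eq_zero (R := R) (u := Pi.single i 1)
    (w := Pi.single j x) (w₀ := Pi.single i 1) (by simp) (by simp [hij]) hk
  simpa [vecMulVec_single_one_single] using this

theorem Matrix.single_sub_single_mem_powerSubgroup (i j : ι) (x : R) (hk : k ≠ 0) :
    single i i x - single j j x ∈ powerSubgroup (Matrix ι ι R) k := by
  rcases eq_or_ne i j with rfl | hij
  · simp
  have := vecMulVec_mem_powerSubgroup_of_dotProduct_eq_zero (R := R)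
    (u := Pi.single i 1 + Pi.single j 1) (w := Pi.single i x - Pi.single j x)
    (w₀ := Pi.single i 1) (by simp [hij]) (by simp [hij, hij.symm]) hk
  simp only [add_vecMulVec, vecMulVec_sub, vecMulVec_single_one_single] at this
  have h := add_mem (sub_mem this (single_mem_powerSubgroup hij.symm x hk))
    (single_mem_powerSubgroup hij x hk)
  convert h using 1
  abel

/-- Modulo sums of powers, a matrix only depends on its trace. -/
theorem Matrix.sub_single_trace_mem_powerSubgroup (M : Matrix ι ι R) (i : ι) (hk : k ≠ 0) :
    M - single i i M.trace ∈ powerSubgroup (Matrix ι ι R) k := by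
  have hM : M - single i i M.trace = ∑ a, ∑ b,
      (single a b (M a b) - if a = b then single i i (M a a) else 0) := by
    simp only [Finset.sum_sub_distrib, Finset.sum_ite_eq, Finset.mem_univ, if_true]
    rw [← matrix_eq_sum_single M]
    congr 1
    exact map_sum (singleAddMonoidHom i i) _ _
  rw [hM]
  refine sum_mem fun a _ => sum_mem fun b _ => ?_
  split_ifs with h
  · subst h
    exact single_sub_single_mem_powerSubgroup a i _ hk
  · simpa using single_mem_powerSubgroup h _ hk

/-- The additive subgroup of `R` generated by the traces of `k`-th powers of matrices. -/
def tracePowerSubgroup (ι R : Type*) [Fintype ι] [DecidableEq ι] [CommRing R] (k : ℕ) :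
    AddSubgroup R :=
  (powerSubgroup (Matrix ι ι R) k).map (traceAddMonoidHom ι R)

theorem Matrix.trace_pow_mem_tracePowerSubgroup (M : Matrix ι ι R) :
    (M ^ k).trace ∈ tracePowerSubgroup ι R k :=
  ⟨_, pow_mem_powerSubgroup M, rfl⟩

theorem tracePowerSubgroup_le_iff {H : AddSubgroup R} :
    tracePowerSubgroup ι R k ≤ H ↔ ∀ M : Matrix ι ι R, (M ^ k).trace ∈ H := by
  rw [tracePowerSubgroup, powerSubgroup, AddSubgroup.map_le_iff_le_comap,
    AddSubgroup.closure_le]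
  exact Set.range_subset_iff

theorem Matrix.mem_powerSubgroup_iff_trace_mem [Nonempty ι] (hk : k ≠ 0) {M : Matrix ι ι R} :
    M ∈ powerSubgroup (Matrix ι ι R) k ↔ M.trace ∈ tracePowerSubgroup ι R k := by
  obtain ⟨i⟩ := ‹Nonempty ι›
  refine ⟨fun h => ⟨M, h, rfl⟩, ?_⟩
  rintro ⟨N, hN, hNM⟩
  have hNM : N.trace = M.trace := hNM
  have hN' := sub_mem hN (sub_single_trace_mem_powerSubgroup N i hk)
  rw [sub_sub_cancel, hNM] at hN'
  simpa using add_mem (sub_single_trace_mem_powerSubgroup M i hk) hN'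

/-- Enlarging the size by zero blocks does not change the trace of a power. -/
theorem Matrix.trace_pow_mem_tracePowerSubgroup_of_injective {κ : Type*} [Fintype κ]
    [DecidableEq κ] {f : κ → ι} (hf : f.Injective) (hk : k ≠ 0) (X : Matrix κ κ R) :
    (X ^ k).trace ∈ tracePowerSubgroup ι R k := by
  -- `P` and `Q` identify the `κ × κ` matrices with a corner of the `ι × ι` matrices.
  let Q : Matrix κ ι R := (1 : Matrix ι ι R).submatrix f id
  let P : Matrix ι κ R := (1 : Matrix ι ι R).submatrix id f
  have hQP : Q * P = 1 := by
    rw [← submatrix_mul _ _ f id f Function.bijective_id, one_mul, submatrix_one _ hf]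
  have hpow (m : ℕ) : (P * X * Q) ^ (m + 1) = P * X ^ (m + 1) * Q := by
    induction m with
    | zero => simp
    | succ m ih =>
      rw [pow_succ, ih, pow_succ X (m + 1)]
      calc P * X ^ (m + 1) * Q * (P * X * Q) = P * X ^ (m + 1) * (Q * P) * X * Q := by
            simp only [Matrix.mul_assoc]
        _ = _ := by rw [hQP, Matrix.mul_one]; simp only [Matrix.mul_assoc]
  obtain ⟨m, rfl⟩ := Nat.exists_eq_succ_of_ne_zero hk
  have := trace_pow_mem_tracePowerSubgroup (k := m + 1) (P * X * Q)
  rwa [hpow, trace_mul_comm, ← Matrix.mul_assoc, hQP, Matrix.one_mul] at this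

end Trace

/-! ### Ghost components and closed walks -/

section WittSet

open WittVector

variable {R : Type*} [CommRing R]

theorem mem_wittSet_iff_exists_ghostComponent (p s : ℕ) [Fact p.Prime] {x : R} :
    x ∈ wittSet p s R ↔ ∃ a : WittVector p R, ghostComponent s a = x := by
  have key (a : WittVector p R) : ghostComponent s a =
      ∑ i ∈ Finset.range (s + 1), (p : R) ^ i * a.coeff i ^ p ^ (s - i) := by
    simp [ghostComponent_apply, wittPolynomial_eq_sum_C_mul_X_pow]
  constructor
  · rintro ⟨a, rfl⟩
    exact ⟨WittVector.mk p a, by simp only [key, coeff_mk]⟩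
  · rintro ⟨a, rfl⟩
    exact ⟨a.coeff, key a⟩

/-- `wittSet p s R` is the range of the ring homomorphism sending a Witt vector to its `s`-th
ghost component. This is why it is stable under addition. -/
noncomputable def wittSubring (p s : ℕ) [Fact p.Prime] (R : Type*) [CommRing R] : Subring R :=
  (ghostComponent (p := p) (R := R) s).range

theorem mem_wittSubring {p s : ℕ} [Fact p.Prime] {x : R} :
    x ∈ wittSubring p s R ↔ x ∈ wittSet p s R :=
  (mem_wittSet_iff_exists_ghostComponent p s).symm

theorem prime_pow_mul_pow_mem_wittSubring {p s i j : ℕ} [Fact p.Prime] (h : i + j = s) (y : R) :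
    (p : R) ^ i * y ^ p ^ j ∈ wittSubring p s R := by
  rw [mem_wittSubring]
  refine ⟨Pi.single i y, ?_⟩
  subst h
  rw [Finset.sum_eq_single i]
  · simp
  · intro b _ hb
    simp [hb, (Fact.out : p.Prime).ne_zero]
  · intro hi
    simp at hi

end WittSet

section Orbits

open Function

/-- Summing an invariant function over the points of exact period `m` is `m` times a sum over
representatives of the orbits. -/
theorem Equiv.Perm.exists_sum_minimalPeriod_eq {X R : Type*} [Fintype X] [DecidableEq X]
    [CommRing R] (σ : Equiv.Perm X) (w : X → R) (hw : ∀ x, w (σ x) = w x) {m : ℕ} (hm : 0 < m) :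
    ∃ S : Finset X, (∀ x ∈ S, minimalPeriod σ x = m) ∧
      ∑ x with minimalPeriod σ x = m, w x = m * ∑ x ∈ S, w x := by
  classical
  -- `r x` is the chosen representative of the orbit of `x`.
  let r : X → X := fun x => Quotient.out (s := SameCycle.setoid σ) (Quotient.mk _ x)
  have hr (x : X) : σ.SameCycle (r x) x := Quotient.mk_out (s := SameCycle.setoid σ) x
  have hr_eq {x y : X} (h : σ.SameCycle x y) : r x = r y :=
    congrArg (Quotient.out (s := SameCycle.setoid σ)) (Quotient.sound h)
  have hiter {x y : X} (h : σ.SameCycle x y) : ∃ k : ℕ, σ^[k] x = y := by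
    obtain ⟨k, -, hk⟩ := h.exists_pow_eq'
    exact ⟨k, by rw [← hk, Equiv.Perm.iterate_eq_pow]⟩
  have hw_iter (k : ℕ) (x : X) : w (σ^[k] x) = w x := by
    induction k with
    | zero => rfl
    | succ k ih => rw [iterate_succ_apply', hw, ih]
  have hper (k : ℕ) (x : X) : minimalPeriod σ (σ^[k] x) = minimalPeriod σ x :=
    minimalPeriod_apply_iterate (σ.injective.mem_periodicPts x) k
  have hsame (k : ℕ) (x : X) : σ.SameCycle x (σ^[k] x) :=
    ⟨k, by rw [Equiv.Perm.iterate_eq_pow, zpow_natCast]⟩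
  let Y : Finset X := {x | minimalPeriod σ x = m}
  have hrY {x : X} (hx : x ∈ Y) : r x ∈ Y := by
    obtain ⟨k, hk⟩ := hiter (hr x).symm
    simp only [Y, Finset.mem_filter, Finset.mem_univ, true_and] at hx ⊢
    rw [← hk, hper, hx]
  have hcard {y : X} (hy : y ∈ Y.image r) : ({x ∈ Y | r x = y} : Finset X).card = m := by
    obtain ⟨z, hz, rfl⟩ := Finset.mem_image.1 hy
    have hp : minimalPeriod σ (r z) = m := by simpa [Y] using hrY hz
    have hrr : r (r z) = r z := hr_eq (hr z)
    have : ({x ∈ Y | r x = r z} : Finset X) = (Finset.range m).image fun k => σ^[k] (r z) := by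
      ext x
      simp only [Finset.mem_filter, Finset.mem_image, Finset.mem_range]
      constructor
      · rintro ⟨hx, hxz⟩
        obtain ⟨k, hk⟩ := hiter (hr x)
        refine ⟨k % m, Nat.mod_lt _ hm, ?_⟩
        rw [← hk, ← hp, hxz, iterate_mod_minimalPeriod_eq]
      · rintro ⟨k, -, rfl⟩
        refine ⟨by simp [Y, hper, hp], ?_⟩
        rw [← hr_eq (hsame k (r z)), hrr]
    rw [this, Finset.card_image_of_injOn, Finset.card_range]
    have := iterate_injOn_Iio_minimalPeriod (f := σ) (x := r z)
    rw [hp] at this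
    simpa using this
  refine ⟨Y.image r, ?_, ?_⟩
  · intro x hx
    obtain ⟨z, hz, rfl⟩ := Finset.mem_image.1 hx
    simpa [Y] using hrY hz
  · calc ∑ x ∈ Y, w x = ∑ x ∈ Y, w (r x) := by
          refine Finset.sum_congr rfl fun x _ => ?_
          obtain ⟨k, hk⟩ := hiter (hr x).symm
          rw [← hk, hw_iter]
      _ = ∑ y ∈ Y.image r, ({x ∈ Y | r x = y} : Finset X).card • w y := Finset.sum_comp w r
      _ = m * ∑ x ∈ Y.image r, w x := by
          rw [Finset.mul_sum]
          refine Finset.sum_congr rfl fun y hy => ?_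
          rw [hcard hy, nsmul_eq_mul]

end Orbits

section Walks

open Matrix Function

variable {ι R : Type*} [Fintype ι] [DecidableEq ι] [CommRing R]

/-- The entries of `A ^ k` count walks of length `k`, weighted by `A`; here `g` is a test function
of the two end points. -/
theorem Matrix.sum_walks_eq (A : Matrix ι ι R) (k : ℕ) (g : ι → ι → R) :
    ∑ f : Fin (k + 1) → ι, (∏ i : Fin k, A (f i.castSucc) (f i.succ)) * g (f 0) (f (Fin.last k)) =
      ∑ a, ∑ b, (A ^ k) a b * g a b := by
  induction k generalizing g with
  | zero =>
    rw [← (Equiv.funUnique (Fin 1) ι).symm.sum_comp]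
    simp [Matrix.one_apply]
  | succ k ih =>
    rw [← (Fin.consEquiv fun _ => ι).sum_comp, Fintype.sum_prod_type]
    refine Finset.sum_congr rfl fun a _ => ?_
    have := ih fun c b => A a c * g a b
    simp only [Fin.consEquiv_apply, Fin.prod_univ_succ, Fin.cons_zero, Fin.castSucc_zero,
      Fin.cons_succ, ← Fin.succ_castSucc, ← Fin.succ_last]
    calc _ = _ := Finset.sum_congr rfl fun f _ => by ring
      _ = _ := this
      _ = _ := by
        rw [Finset.sum_comm]
        refine Finset.sum_congr rfl fun b _ => ?_
        rw [pow_succ', Matrix.mul_apply, Finset.sum_mul]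
        exact Finset.sum_congr rfl fun c _ => by ring

/-- The trace of a power is the weighted number of closed walks, a closed walk of length `k + 1`
being a map from the cyclic group `Fin (k + 1)` to the vertices. -/
theorem Matrix.trace_pow_eq_sum_closed_walks (A : Matrix ι ι R) (k : ℕ) :
    (A ^ (k + 1)).trace = ∑ f : Fin (k + 1) → ι, ∏ i, A (f i) (f (i + 1)) := by
  have := A.sum_walks_eq k fun a b => A b a
  simp only [pow_succ, Matrix.trace, Matrix.diag, Matrix.mul_apply]
  rw [← this]
  refine Finset.sum_congr rfl fun f _ => ?_
  rw [Fin.prod_univ_castSucc]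
  simp [Fin.coeSucc_eq_succ]

theorem Finset.prod_range_mul_of_periodic {M : Type*} [CommMonoid M] {g : ℕ → M} {d : ℕ}
    (hg : Periodic g d) (e : ℕ) : ∏ i ∈ range (d * e), g i = (∏ i ∈ range d, g i) ^ e := by
  induction e with
  | zero => simp
  | succ e ih =>
    rw [Nat.mul_succ, prod_range_add, ih, pow_succ]
    congr 1
    refine prod_congr rfl fun i _ => ?_
    rw [add_comm, mul_comm]
    exact hg.nat_mul e i

open Fin.CommRing in
/-- The trace of a `p ^ s`-th power lies in the Witt set: the cyclic group of order `p ^ s`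
rotates closed walks of length `p ^ s`, and an orbit of size `p ^ j` consists of walks that run
`p ^ (s - j)` times through a closed walk of length `p ^ j`, so it contributes
`p ^ j * y ^ p ^ (s - j)`. -/
theorem Matrix.trace_pow_prime_pow_mem_wittSubring (p s : ℕ) [hp : Fact p.Prime]
    (A : Matrix ι ι R) : (A ^ p ^ s).trace ∈ wittSubring p s R := by
  obtain ⟨k, hk⟩ := Nat.exists_eq_succ_of_ne_zero (pow_pos hp.out.pos s).ne'
  rw [hk, Nat.succ_eq_add_one, trace_pow_eq_sum_closed_walks]
  let w : (Fin (k + 1) → ι) → R := fun f => ∏ i, A (f i) (f (i + 1))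
  let σ : Equiv.Perm (Fin (k + 1) → ι) :=
    (Equiv.addRight (1 : Fin (k + 1))).symm.arrowCongr (.refl ι)
  have hσ (f : Fin (k + 1) → ι) (i) : σ f i = f (i + 1) := rfl
  have hσd (d : ℕ) (f : Fin (k + 1) → ι) (i) : σ^[d] f i = f (i + (d : Fin (k + 1))) := by
    induction d generalizing i with
    | zero => simp
    | succ d ih =>
      rw [iterate_succ_apply', hσ, ih]
      congr 1
      push_cast
      abel
  have hw (f) : w (σ f) = w f :=
    Fintype.prod_equiv (Equiv.addRight 1) _ _ fun i => rfl
  have hper (f) : minimalPeriod σ f ∣ p ^ s := by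
    apply IsPeriodicPt.minimalPeriod_dvd
    ext i
    rw [hσd, hk]
    simp
  have hmaps : ∀ f ∈ (Finset.univ : Finset (Fin (k + 1) → ι)),
      minimalPeriod σ f ∈ (p ^ s).divisors := fun f _ =>
    Nat.mem_divisors.2 ⟨hper f, (pow_pos hp.out.pos s).ne'⟩
  change ∑ f, w f ∈ _
  rw [← Finset.sum_fiberwise_of_maps_to hmaps]
  refine sum_mem fun d hd => ?_
  obtain ⟨j, hj, rfl⟩ := (Nat.dvd_prime_pow hp.out).1 (Nat.dvd_of_mem_divisors hd)
  obtain ⟨S, hS, hSw⟩ := σ.exists_sum_minimalPeriod_eq w hw (pow_pos hp.out.pos j)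
  rw [hSw, Finset.mul_sum]
  refine sum_mem fun f hf => ?_
  have hf : σ^[p ^ j] f = f := hS f hf ▸ iterate_minimalPeriod
  have hwf : w f = (∏ i ∈ Finset.range (p ^ j),
      A (f (i : Fin (k + 1))) (f ((i : Fin (k + 1)) + 1))) ^ p ^ (s - j) := by
    rw [← Finset.prod_range_mul_of_periodic, ← pow_add, Nat.add_sub_cancel' hj, hk,
      Finset.prod_range]
    · simp [w]
    · intro i
      have h (i : Fin (k + 1)) : f (i + (p ^ j : ℕ)) = f i := by
        rw [← hσd (p ^ j) f i, hf]
      beta_reduce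
      rw [Nat.cast_add, h, add_right_comm, h]
  rw [hwf, Nat.cast_pow]
  exact prime_pow_mul_pow_mem_wittSubring (Nat.add_sub_cancel' hj) _

end Walks

/-! ### Traces of cubes and of ninth powers -/

section TwoByTwo

open Matrix

variable {ι R : Type*} [Fintype ι] [DecidableEq ι] [CommRing R]

/-- The trace of the cube of a `2 × 2` matrix with trace `t` and determinant `d` is
`t ^ 3 - 3 * t * d`. -/
theorem dickson_three_mem_tracePowerSubgroup [Nontrivial ι] (t d : R) :
    t ^ 3 - 3 * t * d ∈ tracePowerSubgroup ι R 3 := by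
  obtain ⟨i, j, hij⟩ := exists_pair_ne ι
  have hf : Function.Injective ![i, j] := by
    simpa [Function.Injective, Fin.forall_fin_two, eq_comm] using hij
  have := trace_pow_mem_tracePowerSubgroup_of_injective hf three_ne_zero !![t, -d; 1, 0]
  convert this using 1
  simp only [pow_succ, pow_zero, one_mul, mul_fin_two, trace_fin_two_of]
  ring

/-- The trace of the ninth power of a `2 × 2` matrix with trace `t` and determinant `d` is the
Dickson polynomial of degree `9`. -/
theorem dickson_nine_mem_tracePowerSubgroup [Nontrivial ι] (t d : R) :
    t ^ 9 - 9 * t ^ 7 * d + 27 * t ^ 5 * d ^ 2 - 30 * t ^ 3 * d ^ 3 + 9 * t * d ^ 4 ∈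
      tracePowerSubgroup ι R 9 := by
  obtain ⟨i, j, hij⟩ := exists_pair_ne ι
  have hf : Function.Injective ![i, j] := by
    simpa [Function.Injective, Fin.forall_fin_two, eq_comm] using hij
  have := trace_pow_mem_tracePowerSubgroup_of_injective hf (k := 9) (by norm_num) !![t, -d; 1, 0]
  convert this using 1
  rw [show (9 : ℕ) = 3 * 3 from rfl, pow_mul]
  simp only [pow_succ, pow_zero, one_mul, mul_fin_two, trace_fin_two_of]
  ring

theorem pow_mem_tracePowerSubgroup [Nonempty ι] {k : ℕ} (hk : k ≠ 0) (a : R) :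
    a ^ k ∈ tracePowerSubgroup ι R k := by
  obtain ⟨i⟩ := ‹Nonempty ι›
  have := trace_pow_mem_tracePowerSubgroup_of_injective
    (Function.injective_of_subsingleton fun _ : Unit => i) hk (diagonal fun _ => a)
  simpa [diagonal_pow] using this

theorem eighteen_mul_mem_tracePowerSubgroup [Nontrivial ι] (x : R) :
    18 * x ∈ tracePowerSubgroup ι R 9 := by
  have h := dickson_nine_mem_tracePowerSubgroup (ι := ι) (R := R) 1
  have h1 : (1 : R) ∈ tracePowerSubgroup ι R 9 := by
    simpa using pow_mem_tracePowerSubgroup (ι := ι) (R := R) (k := 9) (by norm_num) 1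
  -- With `P d` the Dickson polynomial at `t = 1`, the combination
  -- `9 P(1 + x) - 5 P(1 - x) + P(-1 - x) - 5 P(-x)` kills all terms of degree above `1`.
  have := sub_mem (add_mem (add_mem (sub_mem (nsmul_mem (h (1 + x)) 9)
    (nsmul_mem (h (1 - x)) 5)) (h (-1 - x))) (neg_mem (nsmul_mem (h (-x)) 5))) (nsmul_mem h1 63)
  convert this using 1
  simp only [nsmul_eq_mul]
  push_cast
  ring

/-- The elements `y` with `9 * y` a combination of traces contain `2 * R` and, by reducing the
Dickson polynomial modulo `2`, all `t ^ 9 + t ^ 7 * d + t ^ 5 * d ^ 2 + t * d ^ 4`. Over `𝔽₂[x]`,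
the sum of the latter over eight pairs `(t, d)` is `x`. -/
theorem nine_mul_mem_tracePowerSubgroup [Nontrivial ι] (x : R) :
    9 * x ∈ tracePowerSubgroup ι R 9 := by
  let N : AddSubgroup R := (tracePowerSubgroup ι R 9).comap (AddMonoidHom.mulLeft 9)
  have h2 (y : R) : 2 * y ∈ N := by
    change 9 * (2 * y) ∈ tracePowerSubgroup ι R 9
    convert eighteen_mul_mem_tracePowerSubgroup (ι := ι) y using 1
    ring
  have h (t d : R) : t ^ 9 + t ^ 7 * d + t ^ 5 * d ^ 2 + t * d ^ 4 ∈ N := by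
    have h9 : t ^ 9 - 9 * t ^ 7 * d + 27 * t ^ 5 * d ^ 2 - 30 * t ^ 3 * d ^ 3 + 9 * t * d ^ 4 ∈
        N := by
      change 9 * _ ∈ tracePowerSubgroup ι R 9
      have := nsmul_mem (dickson_nine_mem_tracePowerSubgroup (ι := ι) t d) 9
      rwa [nsmul_eq_mul, Nat.cast_ofNat] at this
    convert add_mem h9
      (h2 (5 * t ^ 7 * d - 13 * t ^ 5 * d ^ 2 + 15 * t ^ 3 * d ^ 3 - 4 * t * d ^ 4)) using 1
    ring
  change x ∈ N
  convert sub_mem (add_mem (add_mem (add_mem (h (x ^ 2) 0) (h (x ^ 2 + 1) 1))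
    (add_mem (h (x ^ 2) x) (h x (x ^ 5))))
    (add_mem (add_mem (h (x + 1) (x ^ 5)) (h 1 (x ^ 5)))
    (add_mem (h (x ^ 2 + 1) x) (h (x + 1) (x ^ 3)))))
    (h2 (4 + 9 * x + 52 * x ^ 2 + 88 * x ^ 3 + 184 * x ^ 4 + 148 * x ^ 5 + 218 * x ^ 6 +
      84 * x ^ 7 + 193 * x ^ 8 + 45 * x ^ 9 + 154 * x ^ 10 + 17 * x ^ 11 + 95 * x ^ 12 +
      9 * x ^ 13 + 39 * x ^ 14 + 2 * x ^ 15 + 9 * x ^ 16 + 2 * x ^ 18 + x ^ 20 + x ^ 21)) using 1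
  ring

theorem mem_wittSet_three_one {x : R} : x ∈ wittSet 3 1 R ↔ ∃ a b : R, x = a ^ 3 + 3 * b := by
  constructor
  · rintro ⟨a, rfl⟩
    exact ⟨a 0, a 1, by simp [Finset.sum_range_succ]⟩
  · rintro ⟨a, b, rfl⟩
    exact ⟨fun i => if i = 0 then a else b, by simp [Finset.sum_range_succ]⟩

theorem mem_wittSet_three_two {x : R} :
    x ∈ wittSet 3 2 R ↔ ∃ a b c : R, x = a ^ 9 + 3 * b ^ 3 + 9 * c := by
  constructor
  · rintro ⟨a, rfl⟩
    refine ⟨a 0, a 1, a 2, ?_⟩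
    simp [Finset.sum_range_succ]
    norm_num
  · rintro ⟨a, b, c, rfl⟩
    refine ⟨fun i => if i = 0 then a else if i = 1 then b else c, ?_⟩
    simp [Finset.sum_range_succ]
    norm_num

theorem mem_tracePowerSubgroup_three_iff [Nontrivial ι] {x : R} :
    x ∈ tracePowerSubgroup ι R 3 ↔ x ∈ wittSet 3 1 R := by
  constructor
  · rw [← mem_wittSubring]
    exact fun h => tracePowerSubgroup_le_iff (H := (wittSubring 3 1 R).toAddSubgroup).2
      (fun M => M.trace_pow_prime_pow_mem_wittSubring 3 1) h
  · rw [mem_wittSet_three_one]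
    rintro ⟨a, b, rfl⟩
    have h := dickson_three_mem_tracePowerSubgroup (ι := ι) (R := R) 1
    refine add_mem (pow_mem_tracePowerSubgroup three_ne_zero a) ?_
    convert sub_mem (h 0) (h b) using 1
    ring

theorem mem_tracePowerSubgroup_nine_iff [Nontrivial ι] {x : R} :
    x ∈ tracePowerSubgroup ι R 9 ↔ x ∈ wittSet 3 2 R := by
  constructor
  · rw [← mem_wittSubring]
    exact fun h => tracePowerSubgroup_le_iff (H := (wittSubring 3 2 R).toAddSubgroup).2
      (fun M => M.trace_pow_prime_pow_mem_wittSubring 3 2) h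
  · rw [mem_wittSet_three_two]
    rintro ⟨a, b, c, rfl⟩
    have h := dickson_nine_mem_tracePowerSubgroup (ι := ι) (R := R) 1
    refine add_mem (add_mem (pow_mem_tracePowerSubgroup (by norm_num) a) ?_)
      (nine_mul_mem_tracePowerSubgroup c)
    -- Modulo `9 * R`, the Dickson polynomial at `t = 1` is `1 - 3 * b ^ 3`.
    convert add_mem (sub_mem (h 0) (h b))
      (nine_mul_mem_tracePowerSubgroup (ι := ι) (b ^ 4 - b + 3 * b ^ 2 - 3 * b ^ 3)) using 1
    ring

theorem Matrix.isSumOfPowers_three_iff [Nontrivial ι] {M : Matrix ι ι R} :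
    IsSumOfPowers 3 M ↔ M.trace ∈ wittSet 3 1 R := by
  rw [isSumOfPowers_iff_mem_powerSubgroup (by decide),
    mem_powerSubgroup_iff_trace_mem (by norm_num), mem_tracePowerSubgroup_three_iff]

theorem Matrix.isSumOfPowers_nine_iff [Nontrivial ι] {M : Matrix ι ι R} :
    IsSumOfPowers 9 M ↔ M.trace ∈ wittSet 3 2 R := by
  rw [isSumOfPowers_iff_mem_powerSubgroup (by decide),
    mem_powerSubgroup_iff_trace_mem (by norm_num), mem_tracePowerSubgroup_nine_iff]

/-- The terms with `i ≥ 2` are divisible by `9`, and the other two are powers of the required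
kind. -/
theorem wittSet_three_subset {s : ℕ} (hs : 2 ≤ s) : wittSet 3 s R ⊆ wittSet 3 2 R := by
  rintro x ⟨a, rfl⟩
  obtain ⟨r, rfl⟩ := Nat.exists_eq_add_of_le hs
  rw [mem_wittSet_three_two]
  refine ⟨a 0 ^ 3 ^ r, a 1 ^ 3 ^ r,
    ∑ i ∈ Finset.range (r + 1), 3 ^ i * a (i + 2) ^ 3 ^ (r - i), ?_⟩
  rw [show 2 + r + 1 = (r + 1) + 1 + 1 by ring, Finset.sum_range_succ', Finset.sum_range_succ',
    Finset.mul_sum]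
  have h0 : 3 ^ (2 + r - 0) = 3 ^ r * 9 := by rw [Nat.sub_zero, pow_add, mul_comm]; rfl
  have h1 : 3 ^ (2 + r - (0 + 1)) = 3 ^ r * 3 := by
    rw [show 2 + r - (0 + 1) = r + 1 by omega, pow_succ]
  rw [h0, h1, pow_mul, pow_mul]
  have h2 (i : ℕ) : 2 + r - (i + 1 + 1) = r - i := by omega
  simp only [h2, Nat.cast_ofNat, pow_zero, one_mul]
  have hsum : ∑ i ∈ Finset.range (r + 1), (3 : R) ^ (i + 1 + 1) * a (i + 1 + 1) ^ 3 ^ (r - i) =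
      ∑ i ∈ Finset.range (r + 1), 9 * (3 ^ i * a (i + 2) ^ 3 ^ (r - i)) :=
    Finset.sum_congr rfl fun i _ => by ring
  rw [hsum]
  ring

theorem tfae_sum_of_powers [Nontrivial ι] (R : Type*) [CommRing R] :
    List.TFAE
      [∀ M : Matrix ι ι R, IsSumOfPowers 3 M,
       ∀ M : Matrix ι ι R, IsSumOfPowers 9 M,
       EveryElementIsPowerMod R 3 3] := by
  tfae_have 2 → 1 := fun h M => by
    obtain ⟨m, x, hx⟩ := h M
    exact ⟨m, fun i => x i ^ 3, hx.trans (Finset.sum_congr rfl fun i _ => pow_mul (x i) 3 3)⟩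
  tfae_have 1 → 3 := by
    simp only [isSumOfPowers_three_iff, mem_wittSet_three_one]
    intro h x
    obtain ⟨M, rfl⟩ := trace_surjective (n := ι) x
    obtain ⟨a, b, hM⟩ := h M
    rw [hM]
    exact ⟨a, Ideal.mem_span_singleton.2 ⟨b, by ring⟩⟩
  tfae_have 3 → 2 := by
    simp only [isSumOfPowers_nine_iff, mem_wittSet_three_two, EveryElementIsPowerMod,
      Ideal.mem_span_singleton]
    intro h M
    generalize M.trace = x
    obtain ⟨y, z, hz⟩ := h x
    obtain ⟨u, v, hv⟩ := h y
    obtain ⟨b, c, hc⟩ := h z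
    obtain rfl : y = u ^ 3 + 3 * v := by rw [← hv]; ring
    obtain rfl : z = b ^ 3 + 3 * c := by rw [← hc]; ring
    -- If `y ≡ u ^ 3` modulo `3`, then `y ^ 3 ≡ u ^ 9` modulo `9`.
    refine ⟨u, b, u ^ 6 * v + 3 * u ^ 3 * v ^ 2 + 3 * v ^ 3 + c, ?_⟩
    rw [← sub_add_cancel x, hz]
    ring
  tfae_finish

end TwoByTwo

/-! ### Reduced algebras and the discriminant -/

section TraceForm

open TensorProduct

/-- Over a perfect field, the trace form of a reduced finite algebra has trivial radical: such an
algebra is a product of separable field extensions, and it is enough to split off one of them. -/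
theorem Algebra.eq_zero_of_forall_trace_mul_eq_zero {K A : Type*} [Field K] [PerfectField K]
    [CommRing A] [Algebra K A] [Module.Finite K A] [IsReduced A] {x : A}
    (hx : ∀ y, Algebra.trace K A (x * y) = 0) : x = 0 := by
  have : IsArtinianRing A := IsArtinianRing.of_finite K A
  have : IsSemisimpleRing A := IsArtinianRing.isSemisimpleRing_of_isReduced A
  by_contra hx0
  obtain ⟨m, hm, hxm⟩ : ∃ m : Ideal A, m.IsMaximal ∧ x ∉ m := by
    by_contra! h
    refine hx0 ((IsArtinianRing.equivPi A).injective ?_)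
    ext I
    rw [IsArtinianRing.equivPi_apply, map_zero]
    exact Ideal.Quotient.eq_zero_iff_mem.2 (h I.asIdeal I.isMaximal)
  obtain ⟨I, hI⟩ := exists_isCompl m
  obtain ⟨a, ha, b, hb, hab⟩ := Submodule.mem_sup.1
    ((Ideal.eq_top_iff_one _).1 hI.sup_eq_top)
  let φ : A →ₐ[K] (A ⧸ m) × (A ⧸ I) := (Ideal.Quotient.mkₐ K m).prod (Ideal.Quotient.mkₐ K I)
  have hφ (z : A) : φ z = (Ideal.Quotient.mk m z, Ideal.Quotient.mk I z) := rfl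
  have ham : Ideal.Quotient.mk m a = 0 := Ideal.Quotient.eq_zero_iff_mem.2 ha
  have hbI : Ideal.Quotient.mk I b = 0 := Ideal.Quotient.eq_zero_iff_mem.2 hb
  have hbm : Ideal.Quotient.mk m b = 1 := by
    rw [← map_one (Ideal.Quotient.mk m), ← hab, map_add, ham, zero_add]
  have haI : Ideal.Quotient.mk I a = 1 := by
    rw [← map_one (Ideal.Quotient.mk I), ← hab, map_add, hbI, add_zero]
  have hbij : Function.Bijective φ := by
    constructor
    · rw [injective_iff_map_eq_zero]
      intro z hz
      rw [hφ, Prod.mk_eq_zero, Ideal.Quotient.eq_zero_iff_mem, Ideal.Quotient.eq_zero_iff_mem] at hz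
      have := hI.inf_eq_bot.le (Submodule.mem_inf.2 hz)
      exact this
    · rintro ⟨y, z⟩
      obtain ⟨y, rfl⟩ := Ideal.Quotient.mk_surjective y
      obtain ⟨z, rfl⟩ := Ideal.Quotient.mk_surjective z
      refine ⟨y * b + z * a, ?_⟩
      simp [hφ, ham, hbI, hbm, haI]
  let e : A ≃ₐ[K] (A ⧸ m) × (A ⧸ I) := AlgEquiv.ofBijective φ hbij
  let _ := Ideal.Quotient.field m
  obtain ⟨u, hu⟩ := Algebra.trace_surjective K (A ⧸ m) 1
  have hxm' : Ideal.Quotient.mk m x ≠ 0 := fun h => hxm (Ideal.Quotient.eq_zero_iff_mem.1 h)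
  obtain ⟨y, hy⟩ := Ideal.Quotient.mk_surjective ((Ideal.Quotient.mk m x)⁻¹ * u)
  have hxy : e (x * (y * b)) = (u, 0) := by
    change φ _ = _
    rw [hφ]
    simp [hbm, hbI, hy, hxm']
  have := hx (y * b)
  rw [← Algebra.trace_eq_of_algEquiv e, hxy, Algebra.trace_prod_apply, hu, map_zero, add_zero]
    at this
  exact one_ne_zero this

/-- A nilpotent element lies in the radical of the trace form, and for reduced `A` the radical is
zero. -/
theorem Algebra.discr_ne_zero_iff_isReduced {K A ι : Type*} [Field K] [PerfectField K]
    [CommRing A] [Algebra K A] [Fintype ι] [DecidableEq ι] (b : Module.Basis ι K A) :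
    Algebra.discr K b ≠ 0 ↔ IsReduced A := by
  have : Module.Finite K A := .of_basis b
  rw [Algebra.discr_def, Algebra.traceMatrix_of_basis,
    ← LinearMap.BilinForm.nondegenerate_iff_det_ne_zero]
  constructor
  · intro h
    refine ⟨fun x hx => h.1 x fun y => ?_⟩
    exact (LinearMap.isNilpotent_trace_of_isNilpotent
      (((Commute.all x y).isNilpotent_mul_right hx).map (Algebra.lmul K A))).eq_zero
  · intro _
    refine ⟨fun x hx => Algebra.eq_zero_of_forall_trace_mul_eq_zero hx, fun x hx => ?_⟩
    refine Algebra.eq_zero_of_forall_trace_mul_eq_zero (K := K) fun y => ?_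
    rw [mul_comm]
    exact hx y

theorem Algebra.discr_basis_baseChange {R S A ι : Type*} [CommRing R] [CommRing S] [Algebra R S]
    [CommRing A] [Algebra R A] [Fintype ι] [DecidableEq ι] (b : Module.Basis ι R A) :
    Algebra.discr S (Algebra.TensorProduct.basis S b) = algebraMap R S (Algebra.discr R b) := by
  have : Module.Finite R A := .of_basis b
  have : Module.Free R A := .of_basis b
  rw [Algebra.discr_def, Algebra.discr_def, RingHom.map_det]
  congr 1
  ext i j
  rw [RingHom.mapMatrix_apply, Matrix.map_apply, Algebra.traceMatrix_apply,
    Algebra.traceMatrix_apply, Algebra.traceForm_apply, Algebra.traceForm_apply,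
    Algebra.trace_apply, Algebra.trace_apply, ← LinearMap.trace_baseChange,
    Algebra.baseChange_lmul]
  simp

theorem isReduced_iff_frobenius_surjective (p : ℕ) [Fact p.Prime] {A : Type*} [CommRing A]
    [CharP A p] [Finite A] : IsReduced A ↔ Function.Surjective (frobenius A p) := by
  rw [← Finite.injective_iff_surjective]
  refine ⟨fun _ => frobenius_inj A p, fun h => ⟨fun x ⟨n, hx⟩ => ?_⟩⟩
  -- A power `x ^ n = 0` makes the `n`-th iterate of the Frobenius vanish at `x`, as `n < p ^ n`.
  apply h.iterate n
  rw [iterate_frobenius, iterate_frobenius, zero_pow (pow_pos (Fact.out : p.Prime).pos n).ne',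
    ← Nat.sub_add_cancel (Nat.lt_pow_self (Fact.out : p.Prime).one_lt).le, pow_add, hx, mul_zero]

/-- The reduction of `O` modulo `p` is realized as `ZMod p ⊗ O`, to which bases and traces extend. -/
theorem everyElementIsPowerMod_iff_not_dvd_discr (p : ℕ) [hp : Fact p.Prime] {O ι : Type*}
    [CommRing O] [Nontrivial O] [Fintype ι] [DecidableEq ι] (b : Module.Basis ι ℤ O) :
    EveryElementIsPowerMod O p (p : O) ↔ ¬ (p : ℤ) ∣ Algebra.discr ℤ b := by
  let A := ZMod p ⊗[ℤ] O
  let b' : Module.Basis ι (ZMod p) A := Algebra.TensorProduct.basis (ZMod p) b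
  let π : O →+* A := (Algebra.TensorProduct.includeRight : O →ₐ[ℤ] A).toRingHom
  have hπ (x : O) : π x = 1 ⊗ₜ x := rfl
  have hsurj : Function.Surjective π := by
    intro z
    induction z using TensorProduct.induction_on with
    | zero => exact ⟨0, map_zero π⟩
    | tmul c x =>
      obtain ⟨c, rfl⟩ := ZMod.intCast_surjective c
      refine ⟨c • x, ?_⟩
      rw [hπ, TensorProduct.tmul_smul, TensorProduct.smul_tmul', zsmul_one]
    | add y z hy hz =>
      obtain ⟨y, rfl⟩ := hy
      obtain ⟨z, rfl⟩ := hz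
      exact ⟨y + z, map_add π y z⟩
  have hker (x : O) : π x = 0 ↔ x ∈ Ideal.span {(p : O)} := by
    rw [Ideal.mem_span_singleton]
    constructor
    · intro hx
      have hdvd (i : ι) : (p : ℤ) ∣ b.repr x i := by
        have := Algebra.TensorProduct.basis_repr_tmul (A := ZMod p) b 1 x
        rw [← hπ, hx, map_zero] at this
        have := DFunLike.congr_fun this i
        rw [← ZMod.intCast_zmod_eq_zero_iff_dvd]
        simpa using this.symm
      choose c hc using hdvd
      refine ⟨∑ i, c i • b i, ?_⟩
      rw [← b.sum_repr x, Finset.mul_sum]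
      refine Finset.sum_congr rfl fun i _ => ?_
      rw [hc, mul_smul, ← nsmul_eq_mul, natCast_zsmul]
    · rintro ⟨y, rfl⟩
      rw [map_mul, map_natCast, ← map_natCast (algebraMap (ZMod p) A), CharP.cast_eq_zero, map_zero,
        zero_mul]
  have : Nonempty ι := b.index_nonempty
  have : Nontrivial A := b'.repr.toEquiv.nontrivial
  have : CharP A p := charP_of_injective_algebraMap (algebraMap (ZMod p) A).injective p
  have : Module.Finite (ZMod p) A := .of_basis b'
  have : Finite A := Module.finite_of_finite (ZMod p)
  have hdiscr := Algebra.discr_ne_zero_iff_isReduced b'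
  rw [Algebra.discr_basis_baseChange, isReduced_iff_frobenius_surjective p, algebraMap_int_eq,
    eq_intCast, ne_eq, ZMod.intCast_zmod_eq_zero_iff_dvd] at hdiscr
  rw [hdiscr]
  constructor
  · intro h z
    obtain ⟨x, rfl⟩ := hsurj z
    obtain ⟨y, hy⟩ := h x
    rw [← hker, map_sub, map_pow, sub_eq_zero] at hy
    exact ⟨π y, hy.symm⟩
  · intro h x
    obtain ⟨z, hz⟩ := h (π x)
    obtain ⟨y, rfl⟩ := hsurj z
    refine ⟨y, ?_⟩
    rw [← hker, map_sub, map_pow, sub_eq_zero, ← hz, frobenius_def]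

end TraceForm

/-! ### Orders in number fields -/

theorem IsOrder.everyElementIsPowerMod_three_iff {K : Type*} [Field K] [NumberField K]
    {O : Subring K} (hO : IsOrder O) :
    EveryElementIsPowerMod O 3 3 ↔ Int.gcd 3 hO.disc = 1 := by
  have := hO.finite
  have := hO.free
  have h := everyElementIsPowerMod_iff_not_dvd_discr 3 (Module.Free.chooseBasis ℤ O)
  rw [← hO.disc_eq] at h
  push_cast at h
  rw [h, ← Int.isCoprime_iff_gcd_eq_one, Int.prime_three.coprime_iff_not_dvd]

theorem theorem1p1 (n : ℕ) (hn : 2 ≤ n) :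
    (∀ (R : Type*) [CommRing R],
      List.TFAE
        [∀ M : Matrix (Fin n) (Fin n) R, IsSumOfPowers 3 M,
         ∀ M : Matrix (Fin n) (Fin n) R, IsSumOfPowers 9 M,
         EveryElementIsPowerMod R 3 3] ∧
      (∀ M : Matrix (Fin n) (Fin n) R,
        (∃ a₀ a₁ : R, M.trace - (a₀ ^ 9 + 3 * a₁ ^ 3) ∈ Ideal.span {(9 : R)}) ↔
          IsSumOfPowers 9 M) ∧
      (∀ s : ℕ, 2 ≤ s → ∀ M : Matrix (Fin n) (Fin n) R,
        M.trace ∈ wittSet 3 s R → IsSumOfPowers 9 M)) ∧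
    (∀ (K : Type*) [Field K] [NumberField K] (O : Subring K) (hO : IsOrder O),
      List.TFAE
        [∀ M : Matrix (Fin n) (Fin n) O, IsSumOfPowers 3 M,
         ∀ M : Matrix (Fin n) (Fin n) O, IsSumOfPowers 9 M,
         EveryElementIsPowerMod O 3 3,
         Int.gcd 3 hO.disc = 1]) := by
  have : Nontrivial (Fin n) := Fin.nontrivial_iff_two_le.2 hn
  refine ⟨fun R _ => ⟨tfae_sum_of_powers R, fun M => ?_, fun s hs M hM => ?_⟩,
    fun K _ _ O hO => ?_⟩
  · rw [Matrix.isSumOfPowers_nine_iff, mem_wittSet_three_two]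
    simp only [Ideal.mem_span_singleton, Dvd.dvd, sub_eq_iff_eq_add']
  · exact Matrix.isSumOfPowers_nine_iff.2 (wittSet_three_subset hs hM)
  · have h := tfae_sum_of_powers (ι := Fin n) O
    tfae_have 1 ↔ 2 := h.out 0 1
    tfae_have 2 ↔ 3 := h.out 1 2
    tfae_have 3 ↔ 4 := hO.everyElementIsPowerMod_three_iff
    tfae_finish
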